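/- **Proposition (elliptic solution of the Toda chain).** For a lattice $\Lambda=\mathbb Z\,2\omega_1\oplus\mathbb Z\,2\omega_2\subset\mathbb C$ (with $2\omega_1,2\omega_2$ linearly independent over $\mathbb R$) let $$\wp(z)=\frac1{z^2}+\sum_{l\in\Lambda\setminus\{0\}}\Bigl(\frac1{(z-l)^2}-\frac1{l^2}\Bigr),\qquad \zeta(z)=\frac1z+\sum_{l\in\Lambda\setminus\{0\}}\Bigl(\frac1{z-l}+\frac1l+\frac z{l^2}\Bigr),$$ $$\sigma(z)=z\prod_{l\in\Lambda\setminus\{0\}}\Bigl(1-\frac zl\Bigr)e^{z/l+z^2/(2l^2)}$$ be the Weierstrass functions, with invariants $g_2=60\sum_{l\ne0}l^{-4}$, $g_3=140\sum_{l\neq 0}l^{-6}$. The invariants are arbitrary: every pair $(g_2,g_3)\in\mathbb C^2$ with $g_2^3-27g_3^2\ne0$ is the pair of invariants of such a lattice. Further, let $\Lambda$ be any such lattice and let $\omega,p,r,\lambda\in\mathbb C$ be arbitrary with $p\notin\Lambda$. For $n\in\mathbb Z$ and complex time $t$ (in particular, for real $t$) put $$b_n(t)=\omega\bigl(\zeta(\omega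 t-p(n+1)+r)-\zeta(\omega t-pn+r)\bigr)-\lambda,\qquad u_n(t)=\omega^2\bigl(\wp(p)-\wp(\omega t-pn+r)\bigr).$$ Then these functions satisfy the Toda chain equations $$\dot b_n=u_{n+1}-u_n,\qquad \dot u_n=u_n\,(b_n-b_{n-1})$$ wherever all the functions in them are defined: the first equation holds (and $b_n$ is differentiable) at every $t$ with $\omega t-pn+r,\ \omega t-p(n+1)+r\notin\Lambda$, and the second one holds (and $u_n$ is differentiable) at every $t$ with $\omega t-p(n-1)+r,\ \omega t-pn+r,\ \omega t-p(n+1)+r\notin\Lambda$. Moreover, for every $n$ and every $t$ with $\omega t-pn+r\notin\Lambda$, $$u_n(t)=\omega^2\,\frac{\sigma(\omega t-p(n+1)+r)\,\sigma(\omega t-p(n-1)+r)}{\sigma^2(p)\,\sigma^2(\omega t-pn+r)}.$$ -/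

import Mathlib

noncomputable section

/-- The Weierstrass zeta function of a period lattice `Λ`,
`ζ(z) = 1/z + ∑_{l ∈ Λ, l ≠ 0} (1/(z - l) + 1/l + z/l²)`.
Since division by zero gives zero, the term `l = 0` of the sum below is exactly `1/z`. -/
def PeriodPair.weierstrassZeta (L : PeriodPair) (z : ℂ) : ℂ :=
  ∑' l : L.lattice, (1 / (z - l) + 1 / (l : ℂ) + z / (l : ℂ) ^ 2)

/-- The Weierstrass sigma function of a period lattice `Λ`,
`σ(z) = z ∏_{l ∈ Λ, l ≠ 0} (1 - z/l) exp (z/l + z²/(2 l²))`.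
Since division by zero gives zero, the factor `l = 0` of the product below is `1`. -/
def PeriodPair.weierstrassSigma (L : PeriodPair) (z : ℂ) : ℂ :=
  z * ∏' l : L.lattice,
    (1 - z / (l : ℂ)) * Complex.exp (z / (l : ℂ) + z ^ 2 / (2 * (l : ℂ) ^ 2))

/-- The function `b_n(t) = ω (ζ(ωt - p(n+1) + r) - ζ(ωt - pn + r)) - λ`. -/
def PeriodPair.todaB (L : PeriodPair) (ω p r lam : ℂ) (n : ℤ) (t : ℂ) : ℂ :=
  ω * (L.weierstrassZeta (ω * t - p * (n + 1) + r) - L.weierstrassZeta (ω * t - p * n + r)) - lam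

/-- The function `u_n(t) = ω² (℘(p) - ℘(ωt - pn + r))`. -/
def PeriodPair.todaU (L : PeriodPair) (ω p r : ℂ) (n : ℤ) (t : ℂ) : ℂ :=
  ω ^ 2 * (L.weierstrassP p - L.weierstrassP (ω * t - p * n + r))

end

/-! Invariants: up to scaling a lattice is given by a point `τ` of the upper half-plane, and `g₂ ^ 3
: g₃ ^ 2` is governed by `E₄ ^ 3 : E₆ ^ 2`. A weight-12 form not vanishing at the cusp has a zero,
so the prescribed ratio is attained (`ModularForm.exists_E₄_cube_E₆_sq`); a homothety then adjusts
the pair itself.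

Toda equations: with `z = ωt - pn + r`, a step in `n` is a shift of `z` by `-p`. The first equation
is `ζ' = -℘`. Everything else rests on `℘(p) - ℘(z) = σ(z+p)σ(z-p) / (σ(p)²σ(z)²)`
(`sq_weierstrassSigma_mul_weierstrassP_sub`), proved by Liouville's theorem. Its logarithmic
derivative, by `σ'/σ = ζ`, is a second difference of `ζ`, which is the second equation. -/

/-! ### Zeros of level-one modular forms. -/

open UpperHalfPlane ModularForm ModularFormClass MatrixGroups Filter Topology in
/-- A level-one modular form tends at the cusp to the constant term of its `q`-expansion. -/
theorem ModularForm.tendsto_atImInfty_qExpansion_coeff_zero {k : ℤ} (f : ModularForm 𝒮ℒ k) :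
    Tendsto f atImInfty (𝓝 ((qExpansion 1 f).coeff 0)) := by
  have hanal := ModularFormClass.analyticAt_cuspFunction_zero f one_pos one_mem_strictPeriods_SL
  have hper := SlashInvariantFormClass.periodic_comp_ofComplex f one_mem_strictPeriods_SL
  rw [qExpansion_coeff_zero one_pos hanal hper, ← cuspFunction_apply_zero one_pos hanal hper]
  exact (hanal.continuousAt.tendsto.comp (qParam_tendsto_atImInfty one_pos)).congr fun τ ↦
    SlashInvariantFormClass.eq_cuspFunction f τ one_mem_strictPeriods_SL one_ne_zero

open UpperHalfPlane ModularForm ModularFormClass MatrixGroups EisensteinSeries Filter Topology in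
/-- A level-one modular form of positive weight which does not vanish at the cusp has a zero
in the upper half-plane. -/
theorem ModularForm.exists_eq_zero_of_tendsto {k : ℤ} (hk : 0 < k)
    (f : ModularForm 𝒮ℒ k) {c : ℂ} (hc : c ≠ 0) (hf : Tendsto f atImInfty (𝓝 c)) :
    ∃ z, f z = 0 := by
  by_contra! h
  have hslash (γ : SL(2, ℤ)) : (fun z ↦ 1 / f z) ∣[-k] γ = fun z ↦ 1 / f z := by
    have hγ : (γ : GL (Fin 2) ℝ) ∈ 𝒮ℒ := ⟨γ, rfl⟩
    have h1 : ((1 : ℍ → ℂ) / ⇑f) ∣[(0 : ℤ) - k] γ = 1 / ⇑f := by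
      rw [div_slash_SL2, is_invariant_one, SL_slash, SlashInvariantFormClass.slash_action_eq f _ hγ]
    rwa [zero_sub] at h1
  -- Without zeros, `1 / f` is holomorphic, and bounded at the cusp because `c ≠ 0`: a nonzero form
  -- of negative weight, which is impossible.
  let g : ModularForm 𝒮ℒ (-k) :=
    { toFun z := 1 / f z
      slash_action_eq' := fun _ ⟨γ, hγ⟩ ↦ hγ ▸ hslash γ
      holo' := MDifferentiable.div mdifferentiable_const f.holo' h
      bdd_at_cusps' {c} hc := by
        rw [Subgroup.IsArithmetic.isCusp_iff_isCusp_SL2Z] at hc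
        rw [OnePoint.isBoundedAt_iff_forall_SL2Z hc]
        intro γ _
        rw [hslash γ]
        exact (tendsto_const_nhds.div hf ‹_›).isBigO_one ℝ }
  have := congrFun (levelOne_neg_weight_eq_zero (by lia) g) I
  exact one_div_ne_zero (h I) this

-- Both Eisenstein series have constant term 1, so the weight-12 difference tends to `a - b ≠ 0` at
-- the cusp and must vanish somewhere.
open UpperHalfPlane ModularForm MatrixGroups EisensteinSeries Filter in
theorem ModularForm.exists_E₄_cube_E₆_sq (a b : ℂ) (hab : a ≠ b) :
    ∃ z : ℍ, a * E₄ z ^ 3 = b * E₆ z ^ 2 := by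
  let f : ModularForm 𝒮ℒ 12 :=
    a • ModularForm.mcast (by decide) (E₄.pow 3) - b • ModularForm.mcast (by decide) (E₆.pow 2)
  have hf (z : ℍ) : f z = a * E₄ z ^ 3 - b * E₆ z ^ 2 := by
    simp only [f, sub_apply, smul_apply, coe_mcast, coe_pow, Pi.pow_apply, smul_eq_mul]
  have h4 := ModularForm.tendsto_atImInfty_qExpansion_coeff_zero E₄
  have h6 := ModularForm.tendsto_atImInfty_qExpansion_coeff_zero E₆
  rw [E_qExpansion_coeff_zero _ ⟨2, rfl⟩] at h4
  rw [E_qExpansion_coeff_zero _ ⟨3, rfl⟩] at h6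
  obtain ⟨z, hz⟩ := ModularForm.exists_eq_zero_of_tendsto (by norm_num) f (sub_ne_zero.mpr hab)
    ((((h4.pow 3).const_mul a).sub ((h6.pow 2).const_mul b)).congr (fun z ↦ (hf z).symm)
      |>.trans_eq (by simp))
  exact ⟨z, sub_eq_zero.mp ((hf z).symm.trans hz)⟩

theorem riemannZeta_six : riemannZeta 6 = Real.pi ^ 6 / 945 := by
  have h := riemannZeta_two_mul_nat (k := 3) (by norm_num)
  have hb : bernoulli 6 = 1 / 42 := by decide +kernel
  norm_num [hb, Nat.factorial] at h
  rw [h]; ring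

/-! ### Lattices with prescribed invariants. -/

namespace PeriodPair

/-- The period pair `(μ τ, μ)`. -/
def ofUpperHalfPlane (μ : ℂ) (hμ : μ ≠ 0) (τ : UpperHalfPlane) : PeriodPair where
  ω₁ := μ * τ
  ω₂ := μ
  indep := by
    rw [LinearIndependent.pair_iff]
    intro s t h
    have h' : (s : ℂ) * τ + t = 0 := by
      have : μ * ((s : ℂ) * τ + t) = 0 := by
        rw [← h]; simp; ring
      exact (mul_eq_zero.mp this).resolve_left hμ
    have hs : s = 0 := by
      simpa [τ.im_ne_zero] using congrArg Complex.im h'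
    exact ⟨hs, by simpa [hs] using h'⟩

-- Extracting the gcd from each pair of coordinates turns the lattice sum into `ζ(k)` times the sum
-- over coprime pairs, and `E` is half of the latter.
open EisensteinSeries in
theorem G_ofUpperHalfPlane (μ : ℂ) (hμ : μ ≠ 0) (τ : UpperHalfPlane) {k : ℕ} (hk : 3 ≤ k) :
    (ofUpperHalfPlane μ hμ τ).G k = (μ ^ k)⁻¹ * (2 * riemannZeta k * ModularForm.E hk τ) := by
  have h1 : ModularForm.E hk τ = 1 / 2 * eisensteinSeries (N := 1) 0 k τ := rfl
  rw [h1, show ∀ a b : ℂ, 2 * a * (1 / 2 * b) = a * b by intros; ring,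
    ← tsum_eisSummand_eq_riemannZeta_mul_eisensteinSeries hk, ← tsum_mul_left, G,
    ← (ofUpperHalfPlane μ hμ τ).latticeEquivProd.symm.toEquiv.tsum_eq,
    ← (finTwoArrowEquiv ℤ).tsum_eq]
  refine tsum_congr fun v ↦ ?_
  have := (ofUpperHalfPlane μ hμ τ).latticeEquiv_symm_apply ((finTwoArrowEquiv ℤ) v)
  simp only [LinearEquiv.coe_toEquiv] at *
  rw [this, eisSummand, zpow_neg, zpow_natCast, ← mul_inv, ← mul_pow]
  simp [ofUpperHalfPlane]
  ring

/-- Every pair of invariants with nonzero discriminant is that of a period pair. -/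
theorem exists_g₂_g₃_eq (g₂ g₃ : ℂ) (h : g₂ ^ 3 - 27 * g₃ ^ 2 ≠ 0) :
    ∃ L : PeriodPair, L.g₂ = g₂ ∧ L.g₃ = g₃ := by
  obtain ⟨τ, hτ⟩ := ModularForm.exists_E₄_cube_E₆_sq (27 * g₃ ^ 2) (g₂ ^ 3)
    (fun e ↦ h (by rw [e, sub_self]))
  have hΔ : ModularForm.E₄ τ ^ 3 - ModularForm.E₆ τ ^ 2 ≠ 0 := by
    have h1 := ModularForm.discriminant_eq_E₄_cube_sub_E₆_sq τ
    have h2 := ModularForm.discriminant_ne_zero τ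
    grind
  have hπ : (Real.pi : ℂ) ≠ 0 := by exact_mod_cast Real.pi_ne_zero
  have key (μ : ℂ) (hμ : μ ≠ 0) :
      (ofUpperHalfPlane μ hμ τ).g₂ = (μ ^ 4)⁻¹ * (4 / 3 * Real.pi ^ 4 * ModularForm.E₄ τ) ∧
      (ofUpperHalfPlane μ hμ τ).g₃ = (μ ^ 6)⁻¹ * (8 / 27 * Real.pi ^ 6 * ModularForm.E₆ τ) := by
    constructor
    · rw [PeriodPair.g₂, G_ofUpperHalfPlane μ hμ τ (k := 4) (by norm_num)]
      push_cast
      rw [riemannZeta_four]; ring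
    · rw [PeriodPair.g₃, G_ofUpperHalfPlane μ hμ τ (k := 6) (by norm_num)]
      push_cast
      rw [riemannZeta_six]; ring
  set x : ℂ := 4 / 3 * Real.pi ^ 4 * ModularForm.E₄ τ with hx
  set y : ℂ := 8 / 27 * Real.pi ^ 6 * ModularForm.E₆ τ with hy
  have hxy : g₃ ^ 2 * x ^ 3 = g₂ ^ 3 * y ^ 2 := by
    rw [hx, hy]; linear_combination (64 / 729 * (Real.pi : ℂ) ^ 12) * hτ
  have hxy0 : x ^ 3 - 27 * y ^ 2 ≠ 0 := by
    have : x ^ 3 - 27 * y ^ 2 = 64 / 27 * (Real.pi : ℂ) ^ 12 *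
      (ModularForm.E₄ τ ^ 3 - ModularForm.E₆ τ ^ 2) := by rw [hx, hy]; ring
    rw [this]; exact mul_ne_zero (mul_ne_zero (by norm_num) (pow_ne_zero _ hπ)) hΔ
  -- Here `x` and `y` are the invariants for `μ = 1`; `hxy` says that the ratio is already right, so
  -- only the scale `μ` is missing.
  suffices ∃ μ : ℂ, μ ≠ 0 ∧ x = μ ^ 4 * g₂ ∧ y = μ ^ 6 * g₃ by
    obtain ⟨μ, hμ, h4, h6⟩ := this
    refine ⟨ofUpperHalfPlane μ hμ τ, ?_, ?_⟩
    · rw [(key μ hμ).1, h4, inv_mul_cancel_left₀ (pow_ne_zero _ hμ)]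
    · rw [(key μ hμ).2, h6, inv_mul_cancel_left₀ (pow_ne_zero _ hμ)]
  -- If one invariant vanishes, a single root of the other equation gives `μ`.
  by_cases h2 : g₂ = 0
  · have h3 : g₃ ≠ 0 := by rintro rfl; simp [h2] at h
    have hx0 : x = 0 := by simpa [h2, h3] using hxy
    have hy0 : y ≠ 0 := by intro e; simp [hx0, e] at hxy0
    obtain ⟨μ, hμ⟩ := IsAlgClosed.exists_pow_nat_eq (y / g₃) (n := 6) (by norm_num)
    refine ⟨μ, ?_, by rw [hx0, h2, mul_zero], by rw [hμ, div_mul_cancel₀ _ h3]⟩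
    rintro rfl
    exact div_ne_zero hy0 h3 (by rw [← hμ]; norm_num)
  by_cases h3 : g₃ = 0
  · have hy0 : y = 0 := by simpa [h2, h3] using hxy
    have hx0 : x ≠ 0 := by intro e; simp [hy0, e] at hxy0
    obtain ⟨μ, hμ⟩ := IsAlgClosed.exists_pow_nat_eq (x / g₂) (n := 4) (by norm_num)
    refine ⟨μ, ?_, by rw [hμ, div_mul_cancel₀ _ h2], by rw [hy0, h3, mul_zero]⟩
    rintro rfl
    exact div_ne_zero hx0 h2 (by rw [← hμ]; norm_num)
  have hx0 : x ≠ 0 := by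
    intro e
    have : y = 0 := by simpa [e, h2] using hxy
    simp [e, this] at hxy0
  have hy0 : y ≠ 0 := by
    intro e
    have : x = 0 := by simpa [e, h3] using hxy
    simp [e, this] at hxy0
  -- Dividing the two required equations forces this value of `μ ^ 2`.
  obtain ⟨μ, hμ⟩ := IsAlgClosed.exists_pow_nat_eq (y * g₂ / (x * g₃)) (n := 2) (by norm_num)
  refine ⟨μ, ?_, ?_, ?_⟩
  · rintro rfl
    exact div_ne_zero (mul_ne_zero hy0 h2) (mul_ne_zero hx0 h3) (by rw [← hμ]; norm_num)
  · rw [show μ ^ 4 = (μ ^ 2) ^ 2 by ring, hμ]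
    field_simp
    linear_combination hxy
  · rw [show μ ^ 6 = (μ ^ 2) ^ 3 by ring, hμ]
    field_simp
    linear_combination hxy

end PeriodPair
section

open Filter Topology Complex

namespace PeriodPair

variable (L : PeriodPair)

/-! ### The zeta function -/

theorem norm_weierstrassZeta_summand_le (r : ℝ) (hr : 0 < r) (z : ℂ) (hz : ‖z‖ < r) (l : ℂ)
    (h : 2 * r ≤ ‖l‖) : ‖1 / (z - l) + 1 / l + z / l ^ 2‖ ≤ 2 * r ^ 2 * ‖l‖ ^ (-3 : ℝ) := by
  have hl : 0 < ‖l‖ := by linarith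
  have hl0 : l ≠ 0 := norm_pos_iff.mp hl
  have hzl : z - l ≠ 0 := by
    rw [sub_ne_zero]; rintro rfl; linarith
  have hn : ‖l‖ / 2 ≤ ‖z - l‖ := by
    rw [norm_sub_rev]; exact .trans (by linarith) (norm_sub_norm_le l z)
  calc
    _ = ‖z ^ 2 / ((z - l) * l ^ 2)‖ := by congr 1; field_simp; ring
    _ = ‖z‖ ^ 2 / (‖z - l‖ * ‖l‖ ^ 2) := by simp
    _ ≤ r ^ 2 / (‖l‖ / 2 * ‖l‖ ^ 2) := by gcongr
    _ = 2 * r ^ 2 / ‖l‖ ^ 3 := by field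
    _ = _ := by rw [Real.rpow_neg hl.le, div_eq_mul_inv]; norm_cast

theorem hasSumLocallyUniformly_weierstrassZeta :
    HasSumLocallyUniformly
      (fun (l : L.lattice) (z : ℂ) ↦ 1 / (z - l) + 1 / (l : ℂ) + z / (l : ℂ) ^ 2)
      L.weierstrassZeta := by
  refine L.hasSumLocallyUniformly_aux (u := (2 * · ^ 2 * ‖·‖ ^ (-3 : ℝ))) _
    (fun _ _ ↦ (ZLattice.summable_norm_rpow _ _ (by simp; norm_num)).mul_left _) fun r hr ↦
    Filter.eventually_atTop.mpr ⟨2 * r, ?_⟩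
  rintro _ h s hs l rfl
  exact norm_weierstrassZeta_summand_le r hr s hs l h

theorem hasSum_weierstrassZeta (z : ℂ) :
    HasSum (fun l : L.lattice ↦ 1 / (z - l) + 1 / (l : ℂ) + z / (l : ℂ) ^ 2)
      (L.weierstrassZeta z) :=
  L.hasSumLocallyUniformly_weierstrassZeta.hasSum

theorem hasDerivAt_weierstrassZeta_summand (z l : ℂ) (h : z - l ≠ 0) :
    HasDerivAt (fun z : ℂ ↦ 1 / (z - l) + 1 / l + z / l ^ 2) (-(1 / (z - l) ^ 2 - 1 / l ^ 2)) z := by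
  have h1 := ((hasDerivAt_id z).sub_const l).inv h
  have h2 := (hasDerivAt_id z).div_const (l ^ 2)
  convert! (h1.add_const (1 / l)).add h2 using 1
  · ext z; simp
  · simp [neg_div]; ring

theorem hasDerivAt_weierstrassZeta (z : ℂ) (hz : z ∉ L.lattice) :
    HasDerivAt L.weierstrassZeta (-L.weierstrassP z) z := by
  have hsub {x : ℂ} (hx : x ∈ (L.lattice : Set ℂ)ᶜ) (l : L.lattice) : x - l ≠ 0 := by
    rw [sub_ne_zero]; rintro rfl; exact hx l.2
  have hU : IsOpen (L.lattice : Set ℂ)ᶜ := L.isClosed_lattice.isOpen_compl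
  have hd (s : Finset L.lattice) (x : ℂ) (hx : x ∈ (L.lattice : Set ℂ)ᶜ) :=
    HasDerivAt.fun_sum (u := s) fun l _ ↦ hasDerivAt_weierstrassZeta_summand x l (hsub hx l)
  have hT := L.hasSumLocallyUniformly_weierstrassZeta.tendstoLocallyUniformlyOn
    (s := (L.lattice : Set ℂ)ᶜ)
  have hdiff : DifferentiableOn ℂ L.weierstrassZeta (L.lattice : Set ℂ)ᶜ :=
    hT.differentiableOn (.of_forall fun s x hx ↦
      (hd s x hx).differentiableAt.differentiableWithinAt) hU
  have h1 := (hT.deriv (.of_forall fun s x hx ↦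
      (hd s x hx).differentiableAt.differentiableWithinAt) hU).tendsto_at hz
  have h2 := (L.hasSum_weierstrassP z).neg
  -- Locally uniform convergence permits termwise differentiation, and the differentiated series is
  -- that of `-℘`.
  have := tendsto_nhds_unique h1 (h2.congr fun s ↦ ((hd s z hz).deriv).symm)
  rw [← this]
  exact (hdiff.differentiableAt (hU.mem_nhds hz)).hasDerivAt

/-! ### The sigma function -/

/-- The exponential cancels the Taylor polynomial of `log (1 - w)` through order 2, leaving a cubic
error; this makes the product over a rank-2 lattice converge. -/
theorem norm_one_sub_mul_exp_sub_one_le (w : ℂ) (hw : ‖w‖ ≤ 1 / 2) :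
    ‖(1 - w) * exp (w + w ^ 2 / 2) - 1‖ ≤ 2 * ‖w‖ ^ 3 := by
  have h1 : ‖-w‖ < 1 := by rw [norm_neg]; linarith
  have h2 := norm_log_sub_logTaylor_le 2 h1
  have h3 : logTaylor 3 (-w) = -(w + w ^ 2 / 2) := by
    simp [logTaylor, Finset.sum_range_succ]; ring
  rw [h3, norm_neg, sub_neg_eq_add, ← sub_eq_add_neg] at h2
  have hw1 : (1 : ℂ) - w ≠ 0 := by
    rw [sub_ne_zero]; rintro rfl; norm_num at hw
  have hb : ‖log (1 - w) + (w + w ^ 2 / 2)‖ ≤ ‖w‖ ^ 3 := by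
    refine h2.trans ?_
    have : (1 - ‖w‖)⁻¹ ≤ 2 := by
      rw [inv_le_comm₀ (by linarith) (by norm_num)]; linarith
    have h4 : 0 ≤ ‖w‖ ^ 3 := by positivity
    norm_num
    nlinarith
  have hle : ‖w‖ ^ 3 ≤ 1 := pow_le_one₀ (norm_nonneg _) (by linarith)
  have := norm_exp_sub_one_le (hb.trans hle)
  rw [exp_add, exp_log hw1] at this
  linarith

/-- The factor of the Weierstrass product belonging to the lattice point `l`. -/
noncomputable def sigmaFactor (l z : ℂ) : ℂ := (1 - z / l) * exp (z / l + z ^ 2 / (2 * l ^ 2))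

/-- The Weierstrass product, so that `σ(z) = z * sigmaProd z`. -/
noncomputable def sigmaProd (z : ℂ) : ℂ := ∏' l : L.lattice, sigmaFactor l z

theorem weierstrassSigma_eq (z : ℂ) : L.weierstrassSigma z = z * L.sigmaProd z := rfl

theorem differentiable_sigmaFactor (l : ℂ) : Differentiable ℂ (sigmaFactor l) := by
  unfold sigmaFactor; fun_prop

theorem norm_sigmaFactor_sub_one_le (r : ℝ) (z : ℂ) (hz : ‖z‖ ≤ r) (l : ℂ)
    (h : 2 * r ≤ ‖l‖) : ‖sigmaFactor l z - 1‖ ≤ 2 * r ^ 3 * ‖l‖ ^ (-3 : ℝ) := by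
  have hr : 0 ≤ r := (norm_nonneg z).trans hz
  have hw : ‖z / l‖ ≤ 1 / 2 := by
    rw [norm_div]
    exact div_le_of_le_mul₀ (norm_nonneg _) (by norm_num) (by linarith)
  have := norm_one_sub_mul_exp_sub_one_le (z / l) hw
  rw [sigmaFactor, show z ^ 2 / (2 * l ^ 2) = (z / l) ^ 2 / 2 by rw [div_pow]; ring]
  refine this.trans ?_
  rw [norm_div, div_pow, Real.rpow_neg (norm_nonneg _), mul_assoc, div_eq_mul_inv]
  norm_cast
  gcongr

theorem summable_sigmaFactor_bound (r : ℝ) :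
    Summable fun l : L.lattice ↦ 2 * r ^ 3 * ‖(l : ℂ)‖ ^ (-3 : ℝ) :=
  (ZLattice.summable_norm_rpow _ _ (by simp; norm_num)).mul_left _

theorem eventually_cofinite_le_norm (R : ℝ) : ∀ᶠ l : L.lattice in cofinite, R ≤ ‖(l : ℂ)‖ := by
  refine (isCompact_iff_finite.mp (isCompact_closedBall (0 : L.lattice) R)).subset ?_
  intro l hl
  simpa using (not_le.mp (show ¬ R ≤ ‖(l : ℂ)‖ from hl)).le

theorem hasProdLocallyUniformlyOn_sigmaProd (r : ℝ) :
    HasProdLocallyUniformlyOn (fun (l : L.lattice) z ↦ sigmaFactor l z) L.sigmaProd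
      (Metric.ball 0 r) := by
  have := Summable.hasProdLocallyUniformlyOn_one_add (K := Metric.ball (0 : ℂ) r)
    (f := fun (l : L.lattice) z ↦ sigmaFactor l z - 1) Metric.isOpen_ball
    (L.summable_sigmaFactor_bound r) ?_
    fun l ↦ ((differentiable_sigmaFactor _).continuous.sub continuous_const).continuousOn
  · simpa using! this
  · filter_upwards [L.eventually_cofinite_le_norm (2 * r)] with l hl z hz
    exact norm_sigmaFactor_sub_one_le r z (mem_ball_zero_iff.mp hz).le l hl

theorem differentiable_sigmaProd : Differentiable ℂ L.sigmaProd := fun z ↦ by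
  have hz : z ∈ Metric.ball (0 : ℂ) (‖z‖ + 1) := by simp
  exact ((L.hasProdLocallyUniformlyOn_sigmaProd (‖z‖ + 1)).differentiableOn
    (.of_forall fun s ↦ .fun_finsetProd fun i _ ↦ (differentiable_sigmaFactor _).differentiableOn)
    Metric.isOpen_ball).differentiableAt (Metric.isOpen_ball.mem_nhds hz)

theorem sigmaFactor_ne_zero {l z : ℂ} (h : z = l → l = 0) : sigmaFactor l z ≠ 0 := by
  refine mul_ne_zero ?_ (exp_ne_zero _)
  by_cases hl : l = 0
  · simp [hl]
  · rw [one_sub_div hl]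
    exact div_ne_zero (sub_ne_zero.mpr fun e ↦ hl (h e.symm)) hl

theorem sigmaProd_ne_zero {z : ℂ} (hz : z ∈ L.lattice → z = 0) : L.sigmaProd z ≠ 0 := by
  have := tprod_one_add_ne_zero_of_summable (f := fun l : L.lattice ↦ sigmaFactor l z - 1) ?_ ?_
  · simpa [sigmaProd] using this
  · intro l
    simpa using sigmaFactor_ne_zero fun e ↦ by rw [← e]; exact hz (e ▸ l.2)
  · refine (L.summable_sigmaFactor_bound ‖z‖).of_norm_bounded_eventually ?_
    filter_upwards [L.eventually_cofinite_le_norm (2 * ‖z‖)] with l hl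
    simpa using norm_sigmaFactor_sub_one_le ‖z‖ z le_rfl l hl

theorem sigmaProd_eq_zero {z : ℂ} (hz : z ∈ L.lattice) (h0 : z ≠ 0) : L.sigmaProd z = 0 :=
  tprod_of_exists_eq_zero ⟨⟨z, hz⟩, by simp [sigmaFactor, h0]⟩

theorem sigmaProd_zero : L.sigmaProd 0 = 1 := by simp [sigmaProd, sigmaFactor]

theorem sigmaProd_neg (z : ℂ) : L.sigmaProd (-z) = L.sigmaProd z := by
  rw [sigmaProd, ← (Equiv.neg L.lattice).tprod_eq]
  refine tprod_congr fun l ↦ ?_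
  simp [sigmaFactor, neg_div_neg_eq]

/-- The correction accounts for `l = 0`, where the factor is constantly 1 but the zeta summand is `1
/ z`. -/
theorem logDeriv_sigmaFactor {l z : ℂ} (h : z ≠ l) :
    logDeriv (sigmaFactor l) z =
      1 / (z - l) + 1 / l + z / l ^ 2 - if l = 0 then 1 / z else 0 := by
  split_ifs with hl
  · subst hl
    have : sigmaFactor 0 = fun _ ↦ 1 := by ext; simp [sigmaFactor]
    simp [this, logDeriv_apply]
  · have h1 : HasDerivAt (fun z : ℂ ↦ 1 - z / l) (-(1 / l)) z := by
      simpa using ((hasDerivAt_id z).div_const l).const_sub 1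
    have h2 : HasDerivAt (fun z : ℂ ↦ exp (z / l + z ^ 2 / (2 * l ^ 2)))
        (exp (z / l + z ^ 2 / (2 * l ^ 2)) * (1 / l + (2 * z) / (2 * l ^ 2))) z := by
      simpa using (((hasDerivAt_id z).div_const l).add
        ((hasDerivAt_pow 2 z).div_const (2 * l ^ 2))).cexp
    have h3 : HasDerivAt (sigmaFactor l) _ z := h1.mul h2
    rw [logDeriv_apply, h3.deriv, sigmaFactor]
    have := sub_ne_zero.mpr h
    have h4 : l - z ≠ 0 := sub_ne_zero.mpr h.symm
    have := exp_ne_zero (z / l + z ^ 2 / (2 * l ^ 2))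
    have h5 : 1 - z / l ≠ 0 := by rw [one_sub_div hl]; exact div_ne_zero h4 hl
    rw [show -(1 / l) * exp (z / l + z ^ 2 / (2 * l ^ 2)) + (1 - z / l) *
      (exp (z / l + z ^ 2 / (2 * l ^ 2)) * (1 / l + (2 * z) / (2 * l ^ 2))) =
      (-(1 / l) + (1 - z / l) * (1 / l + (2 * z) / (2 * l ^ 2))) *
        exp (z / l + z ^ 2 / (2 * l ^ 2)) by ring, mul_div_mul_right _ _ this,
      one_sub_div hl]
    field_simp
    ring

theorem logDeriv_sigmaProd {z : ℂ} (hz : z ∉ L.lattice) :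
    logDeriv L.sigmaProd z = L.weierstrassZeta z - 1 / z := by
  have hne (l : L.lattice) : z ≠ l := by rintro rfl; exact hz l.2
  have hsum : HasSum (fun l : L.lattice ↦ logDeriv (fun z ↦ sigmaFactor l z) z)
      (L.weierstrassZeta z - 1 / z) := by
    have h0 := hasSum_ite_eq (0 : L.lattice) (1 / z)
    refine ((L.hasSum_weierstrassZeta z).sub h0).congr_fun fun l ↦ ?_
    simpa using! logDeriv_sigmaFactor (hne l)
  rw [← hsum.tsum_eq]
  refine logDeriv_tprod_eq_tsum (Metric.isOpen_ball (x := (0 : ℂ)) (ε := ‖z‖ + 1)) (by simp)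
    (fun l ↦ sigmaFactor_ne_zero fun e ↦ (hne l e).elim)
    (fun l ↦ (differentiable_sigmaFactor _).differentiableOn) hsum.summable
    ⟨_, L.hasProdLocallyUniformlyOn_sigmaProd _⟩
    (L.sigmaProd_ne_zero fun h ↦ (hz h).elim)

theorem differentiable_weierstrassSigma : Differentiable ℂ L.weierstrassSigma :=
  differentiable_id.mul L.differentiable_sigmaProd

theorem weierstrassSigma_neg (z : ℂ) : L.weierstrassSigma (-z) = -L.weierstrassSigma z := by
  simp [weierstrassSigma_eq, sigmaProd_neg]

theorem weierstrassSigma_eq_zero_iff {z : ℂ} : L.weierstrassSigma z = 0 ↔ z ∈ L.lattice := by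
  rw [weierstrassSigma_eq, mul_eq_zero]
  refine ⟨?_, fun h ↦ or_iff_not_imp_left.mpr (L.sigmaProd_eq_zero h)⟩
  rintro (rfl | h)
  · exact zero_mem _
  · by_contra hz
    exact L.sigmaProd_ne_zero (fun h ↦ (hz h).elim) h

theorem hasDerivAt_weierstrassSigma {z : ℂ} (hz : z ∉ L.lattice) :
    HasDerivAt L.weierstrassSigma (L.weierstrassSigma z * L.weierstrassZeta z) z := by
  have hz0 : z ≠ 0 := by rintro rfl; exact hz (zero_mem _)
  have hP : L.sigmaProd z ≠ 0 := L.sigmaProd_ne_zero fun h ↦ (hz h).elim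
  have h1 := L.logDeriv_sigmaProd hz
  rw [logDeriv_apply, div_eq_iff hP] at h1
  convert! (hasDerivAt_id z).mul (L.differentiable_sigmaProd z).hasDerivAt using 1
  rw [h1, weierstrassSigma_eq]
  simp; field_simp; ring

theorem add_coe_mem_lattice_iff {z : ℂ} (l : L.lattice) : z + l ∈ L.lattice ↔ z ∈ L.lattice :=
  add_mem_cancel_right l.2

theorem isPreconnected_compl_lattice : IsPreconnected (L.lattice : Set ℂ)ᶜ :=
  (Set.Countable.isConnected_compl_of_one_lt_rank (by simp)
    (show Countable L.lattice from L.latticeEquivProd.toEquiv.countable_iff.mpr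
      inferInstance).to_set).isPreconnected

/-- By periodicity of `℘` the difference has zero derivative, and the complement of the countable
lattice is connected. -/
theorem exists_weierstrassZeta_add_coe (l : L.lattice) :
    ∃ η : ℂ, ∀ z ∉ L.lattice, L.weierstrassZeta (z + l) = L.weierstrassZeta z + η := by
  have hd (z : ℂ) (hz : z ∉ L.lattice) :
      HasDerivAt (fun z ↦ L.weierstrassZeta (z + l) - L.weierstrassZeta z) 0 z := by
    have h1 := (L.hasDerivAt_weierstrassZeta (z + l)
      (by rwa [L.add_coe_mem_lattice_iff])).comp_add_const z l
    simpa using! h1.sub (L.hasDerivAt_weierstrassZeta z hz)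
  obtain ⟨η, hη⟩ := L.isClosed_lattice.isOpen_compl.exists_is_const_of_deriv_eq_zero
    L.isPreconnected_compl_lattice
    (fun z hz ↦ (hd z hz).differentiableAt.differentiableWithinAt) (fun z hz ↦ (hd z hz).deriv)
  exact ⟨η, fun z hz ↦ by rw [← hη z hz]; ring⟩

/-- Quasi-periodicity of the sigma function. -/
theorem exists_weierstrassSigma_add_coe (l : L.lattice) :
    ∃ c η : ℂ, c ≠ 0 ∧ ∀ z,
      L.weierstrassSigma (z + l) = c * (exp (η * z) * L.weierstrassSigma z) := by
  obtain ⟨η, hη⟩ := L.exists_weierstrassZeta_add_coe l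
  have hσ {z : ℂ} (hz : z ∉ L.lattice) : L.weierstrassSigma z ≠ 0 :=
    fun e ↦ hz (L.weierstrassSigma_eq_zero_iff.mp e)
  have hmem {z : ℂ} (hz : z ∉ L.lattice) : z + l ∉ L.lattice := by
    rwa [L.add_coe_mem_lattice_iff]
  have hf (z : ℂ) (hz : z ∉ L.lattice) : HasDerivAt (fun z ↦ L.weierstrassSigma (z + l)) _ z :=
    (L.hasDerivAt_weierstrassSigma (hmem hz)).comp_add_const z l
  have hg (z : ℂ) (hz : z ∉ L.lattice) :
      HasDerivAt (fun z ↦ exp (η * z) * L.weierstrassSigma z)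
        (exp (η * z) * η * L.weierstrassSigma z +
          exp (η * z) * (L.weierstrassSigma z * L.weierstrassZeta z)) z := by
    have : HasDerivAt (fun z ↦ exp (η * z)) (exp (η * z) * η) z := by
      simpa using ((hasDerivAt_id z).const_mul η).cexp
    exact this.mul (L.hasDerivAt_weierstrassSigma hz)
  -- Off the lattice both functions have logarithmic derivative `ζ(z) + η`, hence are proportional;
  -- on it both vanish.
  obtain ⟨c, hc, h⟩ := (logDeriv_eqOn_iff (s := (L.lattice : Set ℂ)ᶜ)
    (fun z hz ↦ (hf z hz).differentiableAt.differentiableWithinAt)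
    (fun z hz ↦ (hg z hz).differentiableAt.differentiableWithinAt)
    L.isClosed_lattice.isOpen_compl L.isPreconnected_compl_lattice
    (fun z hz ↦ mul_ne_zero (exp_ne_zero _) (hσ hz)) (fun z hz ↦ hσ (hmem hz))).mp (by
      intro z hz
      rw [logDeriv_apply, logDeriv_apply, (hf z hz).deriv, (hg z hz).deriv, hη z hz]
      have h1 := hσ (hmem hz)
      have h2 := hσ hz
      have h3 := exp_ne_zero (η * z)
      field_simp
      ring)
  refine ⟨c, η, hc, fun z ↦ ?_⟩
  by_cases hz : z ∈ L.lattice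
  · rw [L.weierstrassSigma_eq_zero_iff.mpr hz, L.weierstrassSigma_eq_zero_iff.mpr (by
      rwa [L.add_coe_mem_lattice_iff])]
    simp
  · simpa using h hz

/-! ### The elliptic solution of the Toda chain -/

/-- `σ(z + p) σ(z - p) / σ(z)²` is an elliptic function of `z`. -/
theorem sigmaQuotient_add_coe (p z : ℂ) (l : L.lattice) :
    L.weierstrassSigma (z + l + p) * L.weierstrassSigma (z + l - p) /
        L.weierstrassSigma (z + l) ^ 2 =
      L.weierstrassSigma (z + p) * L.weierstrassSigma (z - p) / L.weierstrassSigma z ^ 2 := by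
  obtain ⟨c, η, hc, h⟩ := L.exists_weierstrassSigma_add_coe l
  rw [show z + l + p = z + p + l by ring, show z + l - p = z - p + l by ring, h, h, h,
    mul_add, mul_sub, exp_add, exp_sub]
  have h1 := exp_ne_zero (η * z)
  have h2 := exp_ne_zero (η * p)
  rw [← mul_div_mul_left (L.weierstrassSigma (z + p) * L.weierstrassSigma (z - p)) _
    (pow_ne_zero 2 (mul_ne_zero hc h1))]
  congr 1
  · field_simp
  · ring

/-- An even function which is analytic and vanishes at the origin is divisible by `z²`. -/
theorem _root_.AnalyticAt.exists_eq_sq_mul_of_even {f : ℂ → ℂ} (hf : AnalyticAt ℂ f 0)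
    (he : ∀ z, f (-z) = f z) (h0 : f 0 = 0) :
    ∃ g : ℂ → ℂ, AnalyticAt ℂ g 0 ∧ ∀ z, f z = z ^ 2 * g z := by
  have hd : deriv f 0 = 0 := by
    have h1 : HasDerivAt f (deriv f 0) (-0) := by simpa using hf.differentiableAt.hasDerivAt
    have h2 := h1.scomp (0 : ℂ) (hasDerivAt_neg (0 : ℂ))
    rw [show f ∘ Neg.neg = f from funext he] at h2
    have := h2.deriv
    simpa [CharZero.eq_neg_self_iff] using this
  have key {f : ℂ → ℂ} (hf : AnalyticAt ℂ f 0) : AnalyticAt ℂ (dslope f 0) 0 := by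
    obtain ⟨p, hp⟩ := hf
    exact hp.has_fpower_series_dslope_fslope.analyticAt
  refine ⟨dslope (dslope f 0) 0, key (key hf), fun z ↦ ?_⟩
  have h1 := sub_smul_dslope f 0 z
  have h2 := sub_smul_dslope (dslope f 0) 0 z
  simp only [sub_zero, smul_eq_mul, h0, dslope_same, hd] at h1 h2
  rw [← h1, ← h2]; ring

/-- The difference of `℘`-values as a quotient of sigma functions. -/
theorem sq_weierstrassSigma_mul_weierstrassP_sub {p : ℂ} (hp : p ∉ L.lattice) {z : ℂ}
    (hz : z ∉ L.lattice) :
    L.weierstrassSigma p ^ 2 * (L.weierstrassP p - L.weierstrassP z) =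
      L.weierstrassSigma (z + p) * L.weierstrassSigma (z - p) / L.weierstrassSigma z ^ 2 := by
  classical
  set s : ℂ := L.weierstrassSigma p with hs
  -- The identity amounts to `K` being constant off the lattice: `K p = s ^ 2 * ℘ p`, since `σ 0 =
  -- 0`.
  let K (z : ℂ) : ℂ := s ^ 2 * L.weierstrassP z +
    L.weierstrassSigma (z + p) * L.weierstrassSigma (z - p) / L.weierstrassSigma z ^ 2
  have hK_add (z : ℂ) (l : L.lattice) : K (z + l) = K z := by
    simp only [K, L.sigmaQuotient_add_coe p z l, L.weierstrassP_add_coe]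
  have hσ : Differentiable ℂ L.weierstrassSigma := L.differentiable_weierstrassSigma
  have hσan (z : ℂ) : AnalyticAt ℂ L.weierstrassSigma z := hσ.analyticAt z
  -- the singularity at the origin
  let A (z : ℂ) : ℂ := s ^ 2 * (z ^ 2 * L.weierstrassPExcept 0 z + 1) +
    L.weierstrassSigma (z + p) * L.weierstrassSigma (z - p) / L.sigmaProd z ^ 2
  have hA_an : AnalyticAt ℂ A 0 := by
    have h1 : AnalyticAt ℂ (L.weierstrassPExcept 0) 0 := L.analyticAt_weierstrassPExcept 0
    have h2 : AnalyticAt ℂ L.sigmaProd 0 := L.differentiable_sigmaProd.analyticAt 0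
    have h3 : L.sigmaProd 0 ^ 2 ≠ 0 := by simp [L.sigmaProd_zero]
    have h4 : AnalyticAt ℂ (fun z ↦ L.weierstrassSigma (z + p)) 0 :=
      (hσ.comp (differentiable_id.add_const p)).analyticAt 0
    have h5 : AnalyticAt ℂ (fun z ↦ L.weierstrassSigma (z - p)) 0 :=
      (hσ.comp (differentiable_id.sub_const p)).analyticAt 0
    exact (analyticAt_const.mul (((analyticAt_id.pow 2).mul h1).add analyticAt_const)).add
      ((h4.mul h5).div (h2.pow 2) h3)
  have hA_even (z : ℂ) : A (-z) = A z := by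
    simp only [A, L.sigmaProd_neg, L.weierstrassPExcept_neg, neg_zero]
    rw [show -z + p = -(z - p) by ring, show -z - p = -(z + p) by ring,
      L.weierstrassSigma_neg, L.weierstrassSigma_neg]
    ring
  have hA0 : A 0 = 0 := by
    simp only [A, L.sigmaProd_zero, zero_add, zero_sub, L.weierstrassSigma_neg, ← hs]
    ring
  obtain ⟨g, hg, hgA⟩ := hA_an.exists_eq_sq_mul_of_even hA_even hA0
  have hKg {z : ℂ} (hz : z ≠ 0) : K z = g z := by
    have h1 := hgA z
    have h2 := L.weierstrassPExcept_add 0 z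
    simp only [ZeroMemClass.coe_zero, sub_zero] at h2
    have hz2 : z ^ 2 ≠ 0 := pow_ne_zero 2 hz
    apply mul_left_cancel₀ hz2
    rw [← h1]
    simp only [K, A]
    rw [← h2, L.weierstrassSigma_eq z, mul_pow]
    have : z ^ 2 * (L.weierstrassSigma (z + p) * L.weierstrassSigma (z - p) /
        (z ^ 2 * L.sigmaProd z ^ 2)) =
        L.weierstrassSigma (z + p) * L.weierstrassSigma (z - p) / L.sigmaProd z ^ 2 := by
      rw [← mul_div_assoc, mul_div_mul_left _ _ hz2]
    rw [mul_add, this]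
    field_simp
    simp
  -- the corrected function is entire and doubly periodic
  let F (z : ℂ) : ℂ := if z ∈ L.lattice then g 0 else K z
  have hF_add (z : ℂ) (l : L.lattice) : F (z + l) = F z := by
    simp only [F, L.add_coe_mem_lattice_iff, hK_add]
  have hF0 : AnalyticAt ℂ F 0 := by
    refine hg.congr ?_
    filter_upwards [L.compl_lattice_sdiff_singleton_mem_nhds 0] with w hw
    by_cases h : w = 0
    · simp [F, h]
    · have : w ∉ L.lattice := fun h' ↦ hw ⟨h', h⟩
      simp [F, this, hKg h]
  have hF : Differentiable ℂ F := fun x ↦ by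
    by_cases hx : x ∈ L.lattice
    · have h1 : F = fun y ↦ F (y - x) := by
        ext y
        simpa using hF_add (y - x) ⟨x, hx⟩
      rw [h1]
      have h2 : DifferentiableAt ℂ F (x - x) := by simpa using hF0.differentiableAt
      exact h2.comp (f := fun y ↦ y - x) x (by fun_prop)
    · have hU := L.isClosed_lattice.isOpen_compl.mem_nhds hx
      have hK : DifferentiableAt ℂ K x := by
        have h1 := L.differentiableOn_weierstrassP.differentiableAt hU
        have h2 : L.weierstrassSigma x ^ 2 ≠ 0 :=
          pow_ne_zero 2 fun e ↦ hx (L.weierstrassSigma_eq_zero_iff.mp e)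
        have h4 : DifferentiableAt ℂ (fun z ↦ L.weierstrassSigma (z + p)) x :=
          (hσ.comp (differentiable_id.add_const p)) x
        have h5 : DifferentiableAt ℂ (fun z ↦ L.weierstrassSigma (z - p)) x :=
          (hσ.comp (differentiable_id.sub_const p)) x
        exact (h1.const_mul _).add ((h4.mul h5).div ((hσ x).pow 2) h2)
      refine hK.congr_of_eventuallyEq ?_
      filter_upwards [hU] with w hw
      exact if_neg hw
  -- Liouville: a continuous doubly periodic function has compact range, so the entire function `F`
  -- is constant; compare `p` with `z`.
  have hconst := hF.apply_eq_apply_of_bounded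
    (IsZLattice.isCompact_range_of_periodic L.lattice _ hF.continuous
      fun z w hw ↦ by lift w to L.lattice using hw; exact hF_add z w).isBounded p z
  simp only [F, hp, hz, if_false, K, sub_self,
    L.weierstrassSigma_eq_zero_iff.mpr (zero_mem L.lattice), mul_zero, zero_div, add_zero] at hconst
  rw [mul_sub, hconst]; ring

theorem weierstrassP_sub_weierstrassP {p : ℂ} (hp : p ∉ L.lattice) {z : ℂ} (hz : z ∉ L.lattice) :
    L.weierstrassP p - L.weierstrassP z =
      L.weierstrassSigma (z - p) * L.weierstrassSigma (z + p) /
        (L.weierstrassSigma p ^ 2 * L.weierstrassSigma z ^ 2) := by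
  have hs : L.weierstrassSigma p ^ 2 ≠ 0 :=
    pow_ne_zero 2 fun e ↦ hp (L.weierstrassSigma_eq_zero_iff.mp e)
  rw [← div_div, eq_div_of_mul_eq hs ((mul_comm _ _).trans
    (L.sq_weierstrassSigma_mul_weierstrassP_sub hp hz)), div_right_comm, mul_comm]

/-- Logarithmic differentiation of the sigma quotient; the bracket becomes `b_n - b_{n-1}` up to the
factor `ω`. -/
theorem hasDerivAt_weierstrassP_sub {p : ℂ} (hp : p ∉ L.lattice) {z : ℂ} (hz : z ∉ L.lattice)
    (hz₁ : z - p ∉ L.lattice) (hz₂ : z + p ∉ L.lattice) :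
    HasDerivAt (fun z ↦ L.weierstrassP p - L.weierstrassP z)
      ((L.weierstrassP p - L.weierstrassP z) * (L.weierstrassZeta (z - p) +
        L.weierstrassZeta (z + p) - 2 * L.weierstrassZeta z)) z := by
  have hs : L.weierstrassSigma p ≠ 0 := fun e ↦ hp (L.weierstrassSigma_eq_zero_iff.mp e)
  have hz0 : L.weierstrassSigma z ≠ 0 := fun e ↦ hz (L.weierstrassSigma_eq_zero_iff.mp e)
  have h1 := (L.hasDerivAt_weierstrassSigma hz₁).comp_sub_const z p
  have h2 := (L.hasDerivAt_weierstrassSigma hz₂).comp_add_const z p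
  have h3 := ((L.hasDerivAt_weierstrassSigma hz).pow 2).const_mul (L.weierstrassSigma p ^ 2)
  have h4 := (h1.mul h2).div h3 (mul_ne_zero (pow_ne_zero 2 hs) (pow_ne_zero 2 hz0))
  have h5 := h4.congr_of_eventuallyEq
    (f₁ := fun z ↦ L.weierstrassP p - L.weierstrassP z) (by
      filter_upwards [L.isClosed_lattice.isOpen_compl.mem_nhds hz] with w hw
      exact L.weierstrassP_sub_weierstrassP hp hw)
  convert! h5 using 1
  rw [L.weierstrassP_sub_weierstrassP hp hz]
  simp only [Pi.mul_apply, Pi.pow_apply]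
  field_simp
  push_cast
  ring

theorem hasDerivAt_todaB (ω p r lam : ℂ) (n : ℤ) (t : ℂ) (h₀ : ω * t - p * n + r ∉ L.lattice)
    (h₁ : ω * t - p * (n + 1) + r ∉ L.lattice) :
    HasDerivAt (L.todaB ω p r lam n) (L.todaU ω p r (n + 1) t - L.todaU ω p r n t) t := by
  have hlin (m : ℂ) : HasDerivAt (fun t : ℂ ↦ ω * t - p * m + r) ω t := by
    simpa using (((hasDerivAt_id t).const_mul ω).sub_const (p * m)).add_const r
  have h1 := (L.hasDerivAt_weierstrassZeta _ h₁).comp t (hlin (n + 1))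
  have h2 := (L.hasDerivAt_weierstrassZeta _ h₀).comp t (hlin n)
  convert! ((h1.sub h2).const_mul ω).sub_const lam using 1
  simp only [todaU]
  push_cast
  ring

theorem hasDerivAt_todaU (ω p r lam : ℂ) (hp : p ∉ L.lattice) (n : ℤ) (t : ℂ)
    (h₀ : ω * t - p * n + r ∉ L.lattice) (h₁ : ω * t - p * (n + 1) + r ∉ L.lattice)
    (h₂ : ω * t - p * (n - 1) + r ∉ L.lattice) :
    HasDerivAt (L.todaU ω p r n)
      (L.todaU ω p r n t * (L.todaB ω p r lam n t - L.todaB ω p r lam (n - 1) t)) t := by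
  have hlin : HasDerivAt (fun t : ℂ ↦ ω * t - p * n + r) ω t := by
    simpa using (((hasDerivAt_id t).const_mul ω).sub_const (p * n)).add_const r
  have e₁ : ω * t - p * n + r - p = ω * t - p * (n + 1) + r := by ring
  have e₂ : ω * t - p * n + r + p = ω * t - p * (n - 1) + r := by ring
  have h := L.hasDerivAt_weierstrassP_sub hp h₀ (by rwa [e₁]) (by rwa [e₂])
  rw [e₁, e₂] at h
  convert! (h.comp t hlin).const_mul (ω ^ 2) using 1
  simp only [todaU, todaB]
  push_cast
  rw [sub_add_cancel]
  ring

theorem todaU_eq_weierstrassSigma (ω p r : ℂ) (hp : p ∉ L.lattice) (n : ℤ) (t : ℂ)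
    (h₀ : ω * t - p * n + r ∉ L.lattice) :
    L.todaU ω p r n t =
      ω ^ 2 * (L.weierstrassSigma (ω * t - p * (n + 1) + r) *
          L.weierstrassSigma (ω * t - p * (n - 1) + r) /
        (L.weierstrassSigma p ^ 2 * L.weierstrassSigma (ω * t - p * n + r) ^ 2)) := by
  have e₁ : ω * t - p * n + r - p = ω * t - p * (n + 1) + r := by ring
  have e₂ : ω * t - p * n + r + p = ω * t - p * (n - 1) + r := by ring
  rw [todaU, L.weierstrassP_sub_weierstrassP hp h₀, e₁, e₂]

end PeriodPair

end

theorem mainTheorem12 :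
    -- every pair of invariants with nonzero discriminant is that of a period lattice
    (∀ g₂ g₃ : ℂ, g₂ ^ 3 - 27 * g₃ ^ 2 ≠ 0 → ∃ L : PeriodPair, L.g₂ = g₂ ∧ L.g₃ = g₃) ∧
    -- for every period lattice and all parameters, the Toda equations hold wherever defined
    ∀ (L : PeriodPair) (ω p r lam : ℂ), p ∉ L.lattice → ∀ (n : ℤ) (t : ℂ),
      ω * t - p * n + r ∉ L.lattice →
        (ω * t - p * (n + 1) + r ∉ L.lattice →
          HasDerivAt (L.todaB ω p r lam n)
            (L.todaU ω p r (n + 1) t - L.todaU ω p r n t) t) ∧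
        (ω * t - p * (n + 1) + r ∉ L.lattice → ω * t - p * (n - 1) + r ∉ L.lattice →
          HasDerivAt (L.todaU ω p r n)
            (L.todaU ω p r n t * (L.todaB ω p r lam n t - L.todaB ω p r lam (n - 1) t)) t) ∧
        L.todaU ω p r n t =
          ω ^ 2 * (L.weierstrassSigma (ω * t - p * (n + 1) + r) *
              L.weierstrassSigma (ω * t - p * (n - 1) + r) /
            (L.weierstrassSigma p ^ 2 * L.weierstrassSigma (ω * t - p * n + r) ^ 2)) :=
  ⟨PeriodPair.exists_g₂_g₃_eq, fun L ω p r lam hp n t h₀ ↦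
    ⟨L.hasDerivAt_todaB ω p r lam n t h₀, L.hasDerivAt_todaU ω p r lam hp n t h₀,
      L.todaU_eq_weierstrassSigma ω p r hp n t h₀⟩⟩
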